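/- **Theorem (BSC: meta-converse vs. normal approximation).** Fix a crossover probability $P_{\rm bit}\in(0,\tfrac12)$ and an error probability $P_e\in(0,1)$. For $n\ge1$ and $\mathbf a,\mathbf b\in\{\pm1\}^n$ at Hamming distance $\|\mathbf b-\mathbf a\|_H$, let $$p_{y|x}(\mathbf b|\mathbf a)=(1-P_{\rm bit})^n\Big(\tfrac{P_{\rm bit}}{1-P_{\rm bit}}\Big)^{\|\mathbf b-\mathbf a\|_H},\qquad p_y(\mathbf b)=2^{-n},\qquad \Lambda(\mathbf a,\mathbf b)=\frac1n\ln\frac{p_{y|x}(\mathbf b|\mathbf a)}{p_y(\mathbf b)} .$$ Let $P_{y|\mathbf a}$ and $P_y$ denote probability for $\mathbf y\sim p_{y|x}(\cdot|\mathbf a)$ and $\mathbf y\sim p_y$, respectively. The Polyanskiy–Poor–Verdú (PPV) meta-converse bound on the rate is $$\overline R=\overline R(n)=-\frac1n\log_2\Big(P_y[\Lambda(\mathbf a,\mathbf y)\ge t]-\zeta\,P_y[\Lambda(\mathbf a,\mathbf y)=t]\Big),$$ where the threshold $t\in\mathbb R$ and the randomization $0\le\zeta<1$ are set by $$P_e=P_{y|\mathbf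 a}[\Lambda(\mathbf a,\mathbf y)<t]+\zeta\,P_{y|\mathbf a}[\Lambda(\mathbf a,\mathbf y)=t].$$ Such $t,\zeta$ exist, and the value $\overline R$ depends neither on their choice nor on $\mathbf a$. In terms of $q_n(k;\epsilon)=\binom nk(1-\epsilon)^{n-k}\epsilon^k$ one has $$\overline R=-\frac1n\log_2\Big(\sum_{k=0}^{d}q_n(k;\tfrac12)-\zeta\,q_n(d;\tfrac12)\Big),$$ where $d\in\{0,\dots,n\}$ is the smallest nonnegative integer with $\sum_{k=d+1}^{n}q_n(k;P_{\rm bit})\le P_e$, and $\zeta\in[0,1)$ is defined by $P_e=\sum_{k=d+1}^{n}q_n(k;P_{\rm bit})+\zeta\,q_n(d;P_{\rm bit})$. Then, as $n\to\infty$ with $P_{\rm bit}$ and $P_e$ fixed, $$\overline R=R_{\rm NA}+O(1/n),\qquad R_{\rm NA}=C-\sqrt{\frac Vn}\,\log_2(e)\,Q^{-1}(P_e)+\frac{\log_2 n}{2n},$$ where $C=1+P_{\rm bit}\log_2P_{\rm bit}+(1-P_{\rm bit})\log_2(1-P_{\rm bit})$ is the capacity, $Q$ is the complementary distribution function of the standard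 Gaussian, and $$V=P_{\rm bit}(1-P_{\rm bit})\,\ln^2\Big(\frac{1-P_{\rm bit}}{P_{\rm bit}}\Big)$$ is the channel dispersion. -/

import Mathlib

open MeasureTheory ProbabilityTheory Filter Asymptotics

noncomputable section

namespace BSC

/-- Channel input and output words of length `n` over the alphabet `{1, -1}`. -/
abbrev Word (n : ℕ) : Type := Fin n → ℤˣ

/-- Transition probability `p_{y|x}(b | a)` of the binary symmetric channel with crossover
probability `p`, used `n` times. -/
def trans (p : ℝ) {n : ℕ} (a b : Word n) : ℝ :=
  (1 - p) ^ n * (p / (1 - p)) ^ hammingDist b a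

/-- The capacity achieving output distribution `p_y(b) = 2 ^ (-n)`. -/
def outDist {n : ℕ} (_b : Word n) : ℝ := (1 / 2 : ℝ) ^ n

/-- The normalized log-likelihood `Λ(a, b) = (1 / n) ln (p_{y|x}(b | a) / p_y(b))`. -/
def llr (p : ℝ) {n : ℕ} (a b : Word n) : ℝ :=
  1 / (n : ℝ) * Real.log (trans p a b / outDist b)

open Classical in
/-- False alarm probability `P[Λ(a, y) ≥ t]`, with `y ∼ p_y`. -/
def probFA (p : ℝ) {n : ℕ} (a : Word n) (t : ℝ) : ℝ :=
  ∑ b : Word n with llr p a b ≥ t, outDist b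

open Classical in
/-- Missed detection probability `P[Λ(a, y) < t]`, with `y ∼ p_{y|x}(· | a)`. -/
def probMD (p : ℝ) {n : ℕ} (a : Word n) (t : ℝ) : ℝ :=
  ∑ b : Word n with llr p a b < t, trans p a b

open Classical in
/-- Probability `P[Λ(a, y) = t]` on the threshold, with `y ∼ p_y`. -/
def atomFA (p : ℝ) {n : ℕ} (a : Word n) (t : ℝ) : ℝ :=
  ∑ b : Word n with llr p a b = t, outDist b

open Classical in
/-- Probability `P[Λ(a, y) = t]` on the threshold, with `y ∼ p_{y|x}(· | a)`. -/
def atomMD (p : ℝ) {n : ℕ} (a : Word n) (t : ℝ) : ℝ :=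
  ∑ b : Word n with llr p a b = t, trans p a b

/-- `R` is the value of the PPV meta-converse bound, at the codeword `a` and at error probability
`Pe`: the randomized Neyman-Pearson test accepts `a` if `Λ > t`, rejects it if `Λ < t`, and rejects
it with probability `ζ` if `Λ = t`, where `t` and `ζ` are such that the missed detection probability
is `Pe`; then `R` is `-(1 / n) log₂` of the false alarm probability of the test. -/
def IsMetaConverse (p Pe : ℝ) {n : ℕ} (a : Word n) (R : ℝ) : Prop :=
  ∃ t ζ : ℝ, 0 ≤ ζ ∧ ζ < 1 ∧ Pe = probMD p a t + ζ * atomMD p a t ∧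
    R = -(1 / (n : ℝ)) * Real.logb 2 (probFA p a t - ζ * atomFA p a t)

/-- The binomial probability `q_n(d; ε)`. -/
def binom (n d : ℕ) (ε : ℝ) : ℝ := (n.choose d : ℝ) * (1 - ε) ^ (n - d) * ε ^ d

/-- The binomial distribution function of parameters `n` and `1 / 2` at `d`. -/
def binomFA (n d : ℕ) : ℝ := ∑ k ∈ Finset.Icc 0 d, binom n k (1 / 2)

/-- The complementary binomial distribution function of parameters `n` and `p` at `d`. -/
def binomMD (p : ℝ) (n d : ℕ) : ℝ := ∑ k ∈ Finset.Ioc d n, binom n k p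

/-- The Gaussian complementary distribution function. -/
def gaussQ (x : ℝ) : ℝ := (gaussianReal 0 1).real (Set.Ioi x)

/-- The inverse of `gaussQ`, which is a bijection of `ℝ` onto the interval `(0, 1)`;
meaningful only on that interval. -/
def gaussQInv (ε : ℝ) : ℝ := Function.invFun gaussQ ε

/-- The binary entropy function, in bits. -/
def entropy (x : ℝ) : ℝ := -x * Real.logb 2 x - (1 - x) * Real.logb 2 (1 - x)

/-- The capacity, in bits per channel use. -/
def capacity (p : ℝ) : ℝ := 1 - entropy p

/-- The channel dispersion. -/
def dispersion (p : ℝ) : ℝ := p * (1 - p) * Real.log ((1 - p) / p) ^ 2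

/-- The normal approximation with capacity `C` and dispersion `V`. -/
def normalApprox (C V Pe : ℝ) (n : ℕ) : ℝ :=
  C - √(V / n) * Real.logb 2 (Real.exp 1) * gaussQInv Pe + Real.logb 2 n / (2 * n)

end BSC

end

/-! For `p < 1/2` the log-likelihood strictly decreases in the Hamming distance, so the
Neyman-Pearson test is a threshold test on a binomial variable (`isMetaConverse_of_binom`). Two such
tests with the same missed detection probability coincide as functions, hence the value is unique
(`IsMetaConverse.unique`).

For the asymptotics it suffices to locate the threshold `d` up to O(1). With x = Q⁻¹(Pe) and y = np
+ √(p(1-p)) x √n, a Berry-Esseen estimate at the single point x, proved by Stein's method, shows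
that the binomial tail beyond y is Pe + O(1/√n) (`exists_abs_binomMD_sub_gaussQ_le`). Each binomial
probability within O(√n) of the mean has exact order 1/√n by Stirling (`exists_binom_bounds`), so d
- y = O(1) (`exists_abs_isLeast_sub_gaussQuantile_le`).

The false alarm probability is a lower tail of the symmetric binomial law, cut near np < n/2, hence
within constant factors of its last terms (`binomFA_le`). Passing from 1/2 back to `p`, the
logarithm of such a term is -(ln n)/2 + O(1) plus an affine function of k, whose value at y is
exactly the capacity and dispersion part of -n ln 2 · R_NA; an O(1) shift of k costs O(1)
(`exists_abs_log_binom_half_le`). Division by n finishes. -/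

namespace BSC

/-! ### Neyman-Pearson tests: uniqueness and reduction to binomial sums. -/

/-- A word is determined by the set of positions in which it differs from a given word. -/
def wordEquivFinset {n : ℕ} (a : Word n) : Word n ≃ Finset (Fin n) where
  toFun b := {i | b i ≠ a i}
  invFun s := fun i => if i ∈ s then -a i else a i
  left_inv b := by
    funext i
    by_cases h : b i = a i
    · simp [h]
    · have h' := Int.units_ne_iff_eq_neg.1 h
      simp [h']
  right_inv s := by
    ext i
    by_cases h : i ∈ s <;> simp [h]

theorem sum_word_hammingDist {n : ℕ} (a : Word n) (g : ℕ → ℝ) :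
    ∑ b : Word n, g (hammingDist b a) = ∑ k ∈ Finset.range (n + 1), (n.choose k : ℝ) * g k := by
  have h1 : ∑ b : Word n, g (hammingDist b a) = ∑ s : Finset (Fin n), g s.card :=
    Fintype.sum_equiv (wordEquivFinset a) _ _ fun b => rfl
  have h2 := Finset.sum_powerset_apply_card g (x := (Finset.univ : Finset (Fin n)))
  rw [Finset.powerset_univ, Finset.card_univ, Fintype.card_fin] at h2
  rw [h1, h2]
  simp [nsmul_eq_mul]

section test

open Classical in
/-- The rejection probability of the randomized Neyman-Pearson test with threshold `t` and
randomization `ζ`. -/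
noncomputable def reject (p t ζ : ℝ) {n : ℕ} (a b : Word n) : ℝ :=
  (if llr p a b < t then 1 else 0) + ζ * (if llr p a b = t then 1 else 0)

variable {p : ℝ} {n : ℕ}

theorem probMD_add (a : Word n) (t ζ : ℝ) :
    probMD p a t + ζ * atomMD p a t = ∑ b, reject p t ζ a b * trans p a b := by
  simp only [probMD, atomMD, reject, Finset.sum_filter, Finset.mul_sum, ← Finset.sum_add_distrib]
  refine Finset.sum_congr rfl fun b _ => ?_
  split_ifs <;> ring

theorem probFA_sub (a : Word n) (t ζ : ℝ) :
    probFA p a t - ζ * atomFA p a t = ∑ b, (1 - reject p t ζ a b) * outDist b := by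
  simp only [probFA, atomFA, reject, Finset.sum_filter, Finset.mul_sum, ← Finset.sum_sub_distrib]
  refine Finset.sum_congr rfl fun b _ => ?_
  split_ifs <;> first | (exfalso; order) | ring

/-- The tests are totally ordered by (t, ζ) lexicographically: raising the threshold turns the old
atom into sure rejection, which dominates any randomization there. -/
theorem reject_comparable {t₁ ζ₁ t₂ ζ₂ : ℝ} (h₁ : 0 ≤ ζ₁) (h₁' : ζ₁ < 1) (h₂ : 0 ≤ ζ₂)
    (h₂' : ζ₂ < 1) (a : Word n) :
    (∀ b, reject p t₁ ζ₁ a b ≤ reject p t₂ ζ₂ a b) ∨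
      (∀ b, reject p t₂ ζ₂ a b ≤ reject p t₁ ζ₁ a b) := by
  rcases lt_trichotomy t₁ t₂ with h | h | h
  · left; intro b; unfold reject; split_ifs <;> linarith
  · subst h
    rcases le_total ζ₁ ζ₂ with h | h
    · left; intro b; unfold reject; split_ifs <;> linarith
    · right; intro b; unfold reject; split_ifs <;> linarith
  · right; intro b; unfold reject; split_ifs <;> linarith

theorem trans_pos (hp0 : 0 < p) (hp1 : p < 1) (a b : Word n) : 0 < trans p a b := by
  have : 0 < 1 - p := by linarith
  unfold trans; positivity

theorem eq_of_comparable_of_sum_eq {α : Type*} [Fintype α] {f g w : α → ℝ} (hw : ∀ b, 0 < w b)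
    (h : ∑ b, f b * w b = ∑ b, g b * w b) (hle : ∀ b, f b ≤ g b) : f = g := by
  have := (Finset.sum_eq_sum_iff_of_le (s := Finset.univ)
    fun b _ => mul_le_mul_of_nonneg_right (hle b) (hw b).le).1 h
  funext b
  exact mul_right_cancel₀ (hw b).ne' (this b (Finset.mem_univ b))

/-- The pair (t, ζ) need not be unique, but the rejection function is: comparable functions with
equal sums against positive weights agree. -/
theorem IsMetaConverse.unique (hp0 : 0 < p) (hp1 : p < 1) {Pe : ℝ} {a : Word n} {R₁ R₂ : ℝ}
    (h₁ : IsMetaConverse p Pe a R₁) (h₂ : IsMetaConverse p Pe a R₂) : R₁ = R₂ := by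
  obtain ⟨t₁, ζ₁, h10, h11, h1, rfl⟩ := h₁
  obtain ⟨t₂, ζ₂, h20, h21, h2, rfl⟩ := h₂
  rw [probMD_add] at h1 h2
  rw [probFA_sub, probFA_sub]
  have key : reject p t₁ ζ₁ a = reject p t₂ ζ₂ a := by
    rcases reject_comparable (p := p) (t₁ := t₁) (t₂ := t₂) h10 h11 h20 h21 a with h | h
    · exact eq_of_comparable_of_sum_eq (trans_pos hp0 hp1 a) (h1.symm.trans h2) h
    · exact (eq_of_comparable_of_sum_eq (trans_pos hp0 hp1 a) (h2.symm.trans h1) h).symm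
  rw [key]

/-- The value of the normalized log-likelihood at Hamming distance `k`. -/
noncomputable def llrAt (p : ℝ) (n k : ℕ) : ℝ :=
  1 / (n : ℝ) * Real.log ((1 - p) ^ n * (p / (1 - p)) ^ k / (1 / 2 : ℝ) ^ n)

theorem llrAt_strictAnti (hp0 : 0 < p) (hp1 : p < 1 / 2) (hn : 1 ≤ n) :
    StrictAnti (llrAt p n) := by
  have hq : 0 < 1 - p := by linarith
  have hr : p / (1 - p) < 1 := by rw [div_lt_one hq]; linarith
  intro j k hjk
  unfold llrAt
  have hn' : (0 : ℝ) < n := by exact_mod_cast hn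
  have := pow_lt_pow_right_of_lt_one₀ (div_pos hp0 hq) hr hjk
  gcongr

theorem trans_eq_binom (hp1 : p < 1) {k : ℕ} (hk : k ≤ n) :
    (n.choose k : ℝ) * ((1 - p) ^ n * (p / (1 - p)) ^ k) = binom n k p := by
  have hq : (1 - p) ≠ 0 := by linarith
  unfold binom
  rw [div_pow, ← Nat.sub_add_cancel hk, pow_add, Nat.add_sub_cancel]
  field_simp

theorem binom_half {k : ℕ} (hk : k ≤ n) :
    (n.choose k : ℝ) * (1 / 2) ^ n = binom n k (1 / 2) := by
  unfold binom
  rw [mul_assoc, show (1 - 1 / 2 : ℝ) = 1 / 2 by norm_num, ← pow_add, Nat.sub_add_cancel hk]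

theorem isMetaConverse_of_binom (hp0 : 0 < p) (hp1 : p < 1 / 2) (hn : 1 ≤ n) {Pe ζ : ℝ} {d : ℕ}
    (hd : d ≤ n) (hζ0 : 0 ≤ ζ) (hζ1 : ζ < 1) (hPe : Pe = binomMD p n d + ζ * binom n d p)
    (a : Word n) :
    IsMetaConverse p Pe a
      (-(1 / (n : ℝ)) * Real.logb 2 (binomFA n d - ζ * binom n d (1 / 2))) := by
  have hanti := llrAt_strictAnti hp0 hp1 hn
  have hp1' : p < 1 := by linarith
  -- The threshold is the likelihood level of distance `d`; antitonicity turns `Λ < t` into distance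
  -- greater than `d`.
  refine ⟨llrAt p n d, ζ, hζ0, hζ1, ?_, ?_⟩
  · rw [probMD_add, hPe]
    have h := sum_word_hammingDist a (fun k => ((if d < k then 1 else 0) +
      ζ * (if k = d then 1 else 0)) * ((1 - p) ^ n * (p / (1 - p)) ^ k))
    have h' : ∀ b, reject p (llrAt p n d) ζ a b * trans p a b =
        ((if d < hammingDist b a then 1 else 0) +
          ζ * (if hammingDist b a = d then 1 else 0)) *
            ((1 - p) ^ n * (p / (1 - p)) ^ hammingDist b a) := by
      intro b
      have e : llr p a b = llrAt p n (hammingDist b a) := rfl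
      simp only [reject, trans, e, hanti.lt_iff_gt, hanti.injective.eq_iff]
    rw [Finset.sum_congr rfl fun b _ => h' b, h]
    have h2 : ∀ k ∈ Finset.range (n + 1), (n.choose k : ℝ) *
        (((if d < k then 1 else 0) + ζ * (if k = d then 1 else 0)) *
          ((1 - p) ^ n * (p / (1 - p)) ^ k)) =
        (if d < k then binom n k p else 0) + ζ * (if k = d then binom n k p else 0) := by
      intro k hk
      rw [← trans_eq_binom hp1' (Finset.mem_range_succ_iff.1 hk)]
      split_ifs <;> ring
    rw [Finset.sum_congr rfl h2, Finset.sum_add_distrib, ← Finset.mul_sum, ← Finset.sum_filter,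
      Finset.sum_ite_eq', if_pos (Finset.mem_range_succ_iff.2 hd), binomMD]
    congr 2
    ext k; simp; omega
  · rw [probFA_sub]
    congr 2
    have h := sum_word_hammingDist a (fun k => (1 - ((if d < k then 1 else 0) +
      ζ * (if k = d then 1 else 0))) * (1 / 2 : ℝ) ^ n)
    have h' : ∀ b : Word n, (1 - reject p (llrAt p n d) ζ a b) * outDist b =
        (1 - ((if d < hammingDist b a then 1 else 0) +
          ζ * (if hammingDist b a = d then 1 else 0))) * (1 / 2 : ℝ) ^ n := by
      intro b
      have e : llr p a b = llrAt p n (hammingDist b a) := rfl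
      simp only [reject, outDist, e, hanti.lt_iff_gt, hanti.injective.eq_iff]
    rw [Finset.sum_congr rfl fun b _ => h' b, h]
    have h2 : ∀ k ∈ Finset.range (n + 1), (n.choose k : ℝ) *
        ((1 - ((if d < k then 1 else 0) + ζ * (if k = d then 1 else 0))) * (1 / 2 : ℝ) ^ n) =
        (if k ≤ d then binom n k (1 / 2) else 0) -
          ζ * (if k = d then binom n k (1 / 2) else 0) := by
      intro k hk
      rw [← binom_half (Finset.mem_range_succ_iff.1 hk)]
      split_ifs <;> first | omega | ring
    rw [Finset.sum_congr rfl h2, Finset.sum_sub_distrib, ← Finset.mul_sum, ← Finset.sum_filter,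
      Finset.sum_ite_eq', if_pos (Finset.mem_range_succ_iff.2 hd), binomFA]
    congr 2
    ext k; simp; omega

end test

/-! ### Binomial probabilities and the threshold `d`. -/

theorem binom_nonneg {p : ℝ} (hp0 : 0 ≤ p) (hp1 : p ≤ 1) (n k : ℕ) : 0 ≤ binom n k p := by
  have : 0 ≤ 1 - p := by linarith
  unfold binom; positivity

theorem binom_pos {p : ℝ} (hp0 : 0 < p) (hp1 : p < 1) {n k : ℕ} (hk : k ≤ n) :
    0 < binom n k p := by
  have : 0 < 1 - p := by linarith
  have : 0 < (n.choose k : ℝ) := by exact_mod_cast Nat.choose_pos hk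
  unfold binom; positivity

theorem sum_binom (p : ℝ) (n : ℕ) : ∑ k ∈ Finset.range (n + 1), binom n k p = 1 := by
  have := add_pow p (1 - p) n
  rw [add_sub_cancel, one_pow] at this
  rw [this]
  exact Finset.sum_congr rfl fun k _ => by unfold binom; ring

theorem binomMD_succ {p : ℝ} {n d : ℕ} (hd : d < n) :
    binomMD p n d = binomMD p n (d + 1) + binom n (d + 1) p := by
  unfold binomMD
  rw [← Finset.insert_Ioc_succ_left_eq_Ioc hd, Finset.sum_insert (by simp), add_comm]
  rfl

theorem exists_threshold {p Pe : ℝ} (hp0 : 0 < p) (hp1 : p < 1) (hPe0 : 0 < Pe) (hPe1 : Pe < 1)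
    (n : ℕ) : ∃ (d : ℕ) (ζ : ℝ),
      IsLeast {k : ℕ | binomMD p n k ≤ Pe} d ∧ d ≤ n ∧ 0 ≤ ζ ∧ ζ < 1 ∧
        Pe = binomMD p n d + ζ * binom n d p := by
  classical
  have hex : ∃ k, binomMD p n k ≤ Pe := ⟨n, by simp [binomMD, hPe0.le]⟩
  have hspec := Nat.find_spec hex
  have hle : Nat.find hex ≤ n := Nat.find_min' hex (by simp [binomMD, hPe0.le])
  set d := Nat.find hex with hd
  have hq := binom_pos hp0 hp1 hle
  -- Minimality of `d` gives ζ < 1: the tail starting one index earlier exceeds `Pe`. For `d = 0`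
  -- that tail is the total mass 1.
  have hlt : Pe < binomMD p n d + binom n d p := by
    rcases Nat.eq_zero_or_pos d with h0 | h0
    · have h1 := sum_binom p n
      rw [Finset.range_eq_Ico, Finset.sum_eq_sum_Ico_succ_bot (by omega)] at h1
      have h2 : binomMD p n 0 = ∑ k ∈ Finset.Ico (0 + 1) (n + 1), binom n k p := by
        unfold binomMD
        congr 1
      rw [h0]
      linarith
    · obtain ⟨e, he⟩ : ∃ e, d = e + 1 := ⟨d - 1, by omega⟩
      have h1 := Nat.find_min hex (m := e) (by omega)
      rw [binomMD_succ (by omega), ← he] at h1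
      linarith
  refine ⟨d, (Pe - binomMD p n d) / binom n d p, ⟨hspec, fun k hk => Nat.find_min' hex hk⟩, hle,
    div_nonneg (by linarith) hq.le, ?_, ?_⟩
  · rw [div_lt_one hq]; linarith
  · rw [div_mul_cancel₀ _ hq.ne']; ring

/-! ### Local estimates from Stirling's formula. -/

theorem log_factorial_lower {n : ℕ} (hn : 1 ≤ n) :
    n * Real.log n - n + Real.log n / 2 ≤ Real.log n.factorial := by
  have h := Stirling.le_log_factorial_stirling (n := n) (by omega)
  have : 0 ≤ Real.log (2 * Real.pi) := Real.log_nonneg (by linarith [Real.pi_gt_three])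
  linarith

/-- The Stirling sequence decreases from its value e/√2 at 1, whence the constant 1. -/
theorem log_factorial_upper {n : ℕ} (hn : 1 ≤ n) :
    Real.log n.factorial ≤ n * Real.log n - n + Real.log n / 2 + 1 := by
  have hn' : (0 : ℝ) < n := by exact_mod_cast hn
  have h0 := Stirling.log_stirlingSeq_formula n
  obtain ⟨m, rfl⟩ : ∃ m, n = m + 1 := ⟨n - 1, by omega⟩
  have h1 := Stirling.log_stirlingSeq'_antitone (Nat.zero_le m)
  simp only [Function.comp, Nat.succ_eq_add_one, zero_add] at h1
  rw [Stirling.stirlingSeq_one, Real.log_div (Real.exp_pos _).ne' (by positivity), Real.log_exp,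
    Real.log_sqrt (by norm_num)] at h1
  rw [Real.log_mul (by norm_num) hn'.ne', Real.log_div hn'.ne' (Real.exp_pos _).ne',
    Real.log_exp] at h0
  linarith

theorem log_binom {p : ℝ} (hp0 : 0 < p) (hp1 : p < 1) {n k : ℕ} (hk : k ≤ n) :
    Real.log (binom n k p) = Real.log n.factorial - Real.log k.factorial -
      Real.log (n - k).factorial + (n - k : ℕ) * Real.log (1 - p) + k * Real.log p := by
  have hq : 0 < 1 - p := by linarith
  have hc : (0 : ℝ) < n.choose k := by exact_mod_cast Nat.choose_pos hk
  have hf (j : ℕ) : (j.factorial : ℝ) ≠ 0 := by exact_mod_cast j.factorial_ne_zero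
  have h : (n.factorial : ℝ) = n.choose k * k.factorial * (n - k).factorial := by
    exact_mod_cast (Nat.choose_mul_factorial_mul_factorial hk).symm
  rw [h, binom, Real.log_mul (by positivity) (by positivity),
    Real.log_mul hc.ne' (by positivity), Real.log_mul (mul_ne_zero hc.ne' (hf k)) (hf _),
    Real.log_mul hc.ne' (hf k), Real.log_pow, Real.log_pow]
  ring

/-- Both bounds on a term of a Kullback-Leibler divergence that follow from `log x ≤ x - 1`. -/
theorem mul_log_div_bounds {a b : ℝ} (ha : 0 < a) (hb : 0 < b) :
    a - b ≤ a * (Real.log a - Real.log b) ∧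
      a * (Real.log a - Real.log b) ≤ a - b + (a - b) ^ 2 / b := by
  constructor
  · have h := Real.log_le_sub_one_of_pos (div_pos hb ha)
    rw [Real.log_div hb.ne' ha.ne'] at h
    have h2 := mul_le_mul_of_nonneg_left h ha.le
    have h3 : a * (b / a - 1) = b - a := by field_simp
    linarith
  · have h := Real.log_le_sub_one_of_pos (div_pos ha hb)
    rw [Real.log_div ha.ne' hb.ne'] at h
    have h2 := mul_le_mul_of_nonneg_left h ha.le
    have h3 : a * (a / b - 1) = a - b + (a - b) ^ 2 / b := by field_simp; ring
    linarith

/-- By Stirling, the left side is minus the divergence k ln(k/np) + m ln(m/n(1-p)), m = n - k, up to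
bounded terms, since k and m are comparable to n. The divergence lies between 0 and the chi-square
distance. -/
theorem log_binom_bounds {p : ℝ} (hp0 : 0 < p) (hp1 : p < 1) {n k : ℕ} (hn : 1 ≤ n)
    (h1 : p / 2 * n ≤ k) (h2 : (1 - p) / 2 * n ≤ n - k) :
    Real.log (binom n k p) + Real.log n / 2 ≤
        1 - Real.log (p / 2) / 2 - Real.log ((1 - p) / 2) / 2 ∧
      -2 - (k - n * p) ^ 2 / (n * p) - (k - n * p) ^ 2 / (n * (1 - p)) ≤
        Real.log (binom n k p) + Real.log n / 2 := by
  have hq : 0 < 1 - p := by linarith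
  have hn' : (0 : ℝ) < n := by exact_mod_cast hn
  have hk0 : (0 : ℝ) < k := lt_of_lt_of_le (by positivity) h1
  have hm0 : (0 : ℝ) < n - k := lt_of_lt_of_le (by positivity) h2
  have hkn : k ≤ n := by exact_mod_cast (sub_pos.1 hm0).le
  have hkn' : k < n := by exact_mod_cast (sub_pos.1 hm0)
  have hcast : ((n - k : ℕ) : ℝ) = n - k := Nat.cast_sub hkn
  rw [log_binom hp0 hp1 hkn]
  have fn := log_factorial_lower hn
  have fn' := log_factorial_upper hn
  have fk := log_factorial_lower (n := k) (by exact_mod_cast hk0)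
  have fk' := log_factorial_upper (n := k) (by exact_mod_cast hk0)
  have fm := log_factorial_lower (n := n - k) (by omega)
  have fm' := log_factorial_upper (n := n - k) (by omega)
  rw [hcast] at fm fm' ⊢
  set m : ℝ := (n : ℝ) - k with hm
  have d1 := mul_log_div_bounds hk0 (mul_pos hn' hp0)
  have d2 := mul_log_div_bounds hm0 (mul_pos hn' hq)
  -- The two deviations are opposite, so the linear terms of the two divergence bounds cancel.
  have e2 : m - n * (1 - p) = -(k - n * p) := by rw [hm]; ring
  rw [Real.log_mul hn'.ne' hp0.ne'] at d1
  rw [Real.log_mul hn'.ne' hq.ne', e2, neg_sq] at d2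
  have l1 : Real.log k ≤ Real.log n := Real.log_le_log hk0 (by exact_mod_cast hkn)
  have l2 : Real.log m ≤ Real.log n := Real.log_le_log hm0 (by linarith)
  have l3 := Real.log_le_log (by positivity) h1
  have l4 := Real.log_le_log (by positivity) h2
  rw [Real.log_mul (by positivity) hn'.ne'] at l3 l4
  have e3 : (n : ℝ) * Real.log n = k * Real.log n + m * Real.log n := by rw [hm]; ring
  constructor
  · nlinarith [d1.1, d2.1]
  · nlinarith [d1.2, d2.2]

theorem exists_abs_log_binom_le {p : ℝ} (hp0 : 0 < p) (hp1 : p < 1) (K : ℝ) :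
    ∃ C : ℝ, ∀ᶠ n : ℕ in atTop, ∀ k : ℕ, |(k : ℝ) - n * p| ≤ K * √n →
      k ≤ n ∧ |Real.log (binom n k p) + Real.log n / 2| ≤ C := by
  have hq : 0 < 1 - p := by linarith
  refine ⟨max (1 - Real.log (p / 2) / 2 - Real.log ((1 - p) / 2) / 2)
    (2 + K ^ 2 / p + K ^ 2 / (1 - p)), ?_⟩
  have ht : Tendsto (fun n : ℕ => √(n : ℝ)) atTop atTop :=
    Real.tendsto_sqrt_atTop.comp tendsto_natCast_atTop_atTop
  filter_upwards [ht.eventually_ge_atTop (K / (p / 2)), ht.eventually_ge_atTop (K / ((1 - p) / 2)),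
    eventually_ge_atTop 1] with n h1 h2 hn k hk
  have hn' : (0 : ℝ) < n := by exact_mod_cast hn
  have hs := Real.mul_self_sqrt hn'.le
  have hs0 : 0 < √(n : ℝ) := Real.sqrt_pos.2 hn'
  rw [div_le_iff₀ (by positivity)] at h1 h2
  have h1' := mul_le_mul_of_nonneg_right h1 hs0.le
  have h2' := mul_le_mul_of_nonneg_right h2 hs0.le
  have hk' := abs_le.1 hk
  have a1 : p / 2 * n ≤ k := by rw [← hs] at *; nlinarith
  have a2 : (1 - p) / 2 * n ≤ n - k := by nlinarith
  have hkn : (k : ℝ) ≤ n := by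
    have : 0 ≤ (1 - p) / 2 * n := by positivity
    linarith
  refine ⟨by exact_mod_cast hkn, ?_⟩
  obtain ⟨b1, b2⟩ := log_binom_bounds hp0 hp1 hn a1 a2
  have hsq : ((k : ℝ) - n * p) ^ 2 ≤ K ^ 2 * n := by
    have := sq_le_sq' hk'.1 hk'.2
    rwa [mul_pow, Real.sq_sqrt hn'.le] at this
  have c1 : ((k : ℝ) - n * p) ^ 2 / (n * p) ≤ K ^ 2 / p := by
    rw [div_le_div_iff₀ (by positivity) hp0]; nlinarith
  have c2 : ((k : ℝ) - n * p) ^ 2 / (n * (1 - p)) ≤ K ^ 2 / (1 - p) := by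
    rw [div_le_div_iff₀ (by positivity) hq]; nlinarith
  rw [abs_le]
  constructor
  · have := le_max_right (1 - Real.log (p / 2) / 2 - Real.log ((1 - p) / 2) / 2)
      (2 + K ^ 2 / p + K ^ 2 / (1 - p))
    linarith
  · exact b1.trans (le_max_left _ _)

/-- The upper bound controls the discontinuity in the Berry-Esseen argument; the lower bound
converts gaps in probability into gaps in index. -/
theorem exists_binom_bounds {p : ℝ} (hp0 : 0 < p) (hp1 : p < 1) (K : ℝ) :
    ∃ c C : ℝ, 0 < c ∧ 0 < C ∧ ∀ᶠ n : ℕ in atTop, ∀ k : ℕ, |(k : ℝ) - n * p| ≤ K * √n →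
      k ≤ n ∧ c / √n ≤ binom n k p ∧ binom n k p ≤ C / √n := by
  obtain ⟨C, hC⟩ := exists_abs_log_binom_le hp0 hp1 K
  refine ⟨Real.exp (-C), Real.exp C, Real.exp_pos _, Real.exp_pos _, ?_⟩
  filter_upwards [hC, eventually_ge_atTop 1] with n h hn k hk
  obtain ⟨hkn, h⟩ := h k hk
  have hn' : (0 : ℝ) < n := by exact_mod_cast hn
  have hs0 : 0 < √(n : ℝ) := Real.sqrt_pos.2 hn'
  have hb := binom_pos hp0 hp1 hkn
  rw [abs_le, ← Real.log_sqrt hn'.le, ← Real.log_mul hb.ne' hs0.ne',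
    Real.le_log_iff_exp_le (by positivity), Real.log_le_iff_le_exp (by positivity)] at h
  exact ⟨hkn, (div_le_iff₀ hs0).2 h.1, (le_div_iff₀ hs0).2 h.2⟩

/-! ### Stein identity and moments of the binomial law. -/

section moments

theorem binom_succ (p : ℝ) {n k : ℕ} (hk : k ≤ n) :
    (1 - p) * (k + 1) * binom n (k + 1) p = p * (n - k) * binom n k p := by
  rcases hk.eq_or_lt with rfl | hk'
  · simp [binom]
  have h : (n.choose (k + 1) : ℝ) * (k + 1) = n.choose k * (n - k) := by
    rw [← Nat.cast_sub hk]
    exact_mod_cast Nat.choose_succ_right_eq n k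
  unfold binom
  obtain ⟨j, rfl⟩ : ∃ j, n = k + 1 + j := ⟨n - (k + 1), by omega⟩
  rw [show k + 1 + j - (k + 1) = j by omega, show k + 1 + j - k = j + 1 by omega]
  linear_combination (1 - p) ^ (j + 1) * p ^ (k + 1) * h

/-- The Stein identity of the binomial distribution. -/
theorem sum_binom_stein (p : ℝ) (n : ℕ) (g : ℕ → ℝ) :
    ∑ k ∈ Finset.range (n + 1), binom n k p * ((k - n * p) * g k) =
      ∑ k ∈ Finset.range (n + 1), binom n k p * (p * (n - k) * (g (k + 1) - g k)) := by
  have h : ∑ k ∈ Finset.range (n + 1), p * (n - k) * binom n k p * g (k + 1) =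
      ∑ k ∈ Finset.range (n + 1), (1 - p) * k * binom n k p * g k := by
    have h1 : ∀ k ∈ Finset.range (n + 1), p * (n - k) * binom n k p * g (k + 1) =
        (1 - p) * (k + 1 : ℕ) * binom n (k + 1) p * g (k + 1) := by
      intro k hk
      rw [← binom_succ p (Finset.mem_range_succ_iff.1 hk)]
      push_cast; ring
    rw [Finset.sum_congr rfl h1]
    have h2 := Finset.sum_range_succ' (fun k : ℕ => (1 - p) * k * binom n k p * g k) (n + 1)
    rw [Finset.sum_range_succ] at h2
    have h3 : binom n (n + 1) p = 0 := by simp [binom]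
    simpa [h3] using h2.symm
  rw [← sub_eq_zero, ← Finset.sum_sub_distrib]
  rw [← sub_eq_zero, ← Finset.sum_sub_distrib] at h
  rw [← neg_eq_zero, ← Finset.sum_neg_distrib, ← h]
  refine Finset.sum_congr rfl fun k _ => by ring

theorem sum_binom_sub_mean (p : ℝ) (n : ℕ) :
    ∑ k ∈ Finset.range (n + 1), binom n k p * ((k : ℝ) - n * p) = 0 := by
  simpa using sum_binom_stein p n (fun _ => 1)

theorem sum_binom_variance (p : ℝ) (n : ℕ) :
    ∑ k ∈ Finset.range (n + 1), binom n k p * ((k : ℝ) - n * p) ^ 2 = n * (p * (1 - p)) := by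
  have h := sum_binom_stein p n (fun k => k - n * p)
  have h' : ∀ k ∈ Finset.range (n + 1), binom n k p * (p * (n - k) *
      ((((k + 1 : ℕ) : ℝ) - n * p) - (k - n * p))) =
      (n * (p * (1 - p))) * binom n k p - p * (binom n k p * (k - n * p)) := by
    intro k _
    push_cast; ring
  rw [Finset.sum_congr rfl h', Finset.sum_sub_distrib, ← Finset.mul_sum, ← Finset.mul_sum,
    sum_binom, sum_binom_sub_mean] at h
  rw [Finset.sum_congr rfl fun k _ => by rw [pow_two], h]
  ring

end moments

/-! ### Gaussian tail, Mills ratio and Stein's equation. -/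

open Set in
theorem gaussQ_eq_integral (x : ℝ) : gaussQ x = ∫ u in Ioi x, gaussianPDFReal 0 1 u := by
  rw [gaussQ, measureReal_def, gaussianReal_apply_eq_integral 0 one_ne_zero,
    ENNReal.toReal_ofReal (integral_nonneg fun u => gaussianPDFReal_nonneg 0 1 u)]

theorem continuous_gaussianPDFReal : Continuous (gaussianPDFReal 0 1) := by
  rw [gaussianPDFReal_def]; fun_prop

theorem hasDerivAt_gaussianPDFReal (w : ℝ) :
    HasDerivAt (gaussianPDFReal 0 1) (-(w * gaussianPDFReal 0 1 w)) w := by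
  rw [gaussianPDFReal_def]
  have h : HasDerivAt (fun x : ℝ => -(x - 0) ^ 2 / (2 * ((1 : NNReal) : ℝ))) (-w) w := by
    convert! ((((hasDerivAt_id w).sub_const 0).pow 2).neg.div_const (2 * ((1 : NNReal) : ℝ)))
      using 1
    simp
    ring
  convert! (h.exp).const_mul _ using 1
  ring

theorem gaussianPDFReal_neg (w : ℝ) : gaussianPDFReal 0 1 (-w) = gaussianPDFReal 0 1 w := by
  simp [gaussianPDFReal_def]

theorem tendsto_gaussianPDFReal_atTop : Tendsto (gaussianPDFReal 0 1) atTop (nhds 0) := by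
  rw [gaussianPDFReal_def]
  have h : Tendsto (fun x : ℝ => -(x - 0) ^ 2 / (2 * ((1 : NNReal) : ℝ))) atTop atBot := by
    have h1 : Tendsto (fun x : ℝ => x ^ 2 / 2) atTop atTop :=
      (tendsto_pow_atTop two_ne_zero).atTop_div_const two_pos
    convert! tendsto_neg_atTop_atBot.comp h1 using 2 with x
    simp; ring
  simpa using (Real.tendsto_exp_atBot.comp h).const_mul (√(2 * Real.pi * ((1 : NNReal) : ℝ)))⁻¹

theorem gaussQ_nonneg (x : ℝ) : 0 ≤ gaussQ x := measureReal_nonneg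

theorem gaussQ_le_one (x : ℝ) : gaussQ x ≤ 1 := measureReal_le_one

theorem gaussQ_neg (x : ℝ) : gaussQ (-x) = 1 - gaussQ x := by
  have h1 : gaussQ (-x) = ∫ u in Set.Iic x, gaussianPDFReal 0 1 u := by
    rw [gaussQ_eq_integral, ← integral_comp_neg_Iic]
    simp only [gaussianPDFReal_neg]
  have h2 := intervalIntegral.integral_Iic_add_Ioi (b := x)
    (integrable_gaussianPDFReal 0 1).integrableOn (integrable_gaussianPDFReal 0 1).integrableOn
  rw [integral_gaussianPDFReal_eq_one 0 one_ne_zero, ← h1, ← gaussQ_eq_integral] at h2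
  linarith

theorem hasDerivAt_gaussQ (x : ℝ) : HasDerivAt gaussQ (-gaussianPDFReal 0 1 x) x := by
  have h : gaussQ = fun y => gaussQ 0 - ∫ u in (0 : ℝ)..y, gaussianPDFReal 0 1 u := by
    funext y
    rw [gaussQ_eq_integral, gaussQ_eq_integral,
      ← intervalIntegral.integral_Ioi_sub_Ioi' (integrable_gaussianPDFReal 0 1).integrableOn
      (integrable_gaussianPDFReal 0 1).integrableOn]
    ring
  rw [h]
  exact (continuous_gaussianPDFReal.integral_hasStrictDerivAt 0 x).hasDerivAt.const_sub _

theorem continuous_gaussQ : Continuous gaussQ :=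
  continuous_iff_continuousAt.2 fun x => (hasDerivAt_gaussQ x).continuousAt

theorem gaussQ_eq_one_sub_cdf (x : ℝ) : gaussQ x = 1 - cdf (gaussianReal 0 1) x := by
  rw [gaussQ, cdf_eq_real, ← Set.compl_Iic, probReal_compl_eq_one_sub measurableSet_Iic]

theorem gaussQ_gaussQInv {ε : ℝ} (h0 : 0 < ε) (h1 : ε < 1) : gaussQ (gaussQInv ε) = ε := by
  refine Function.invFun_eq ?_
  have ht : Tendsto gaussQ atTop (nhds 0) := by
    simpa only [← gaussQ_eq_one_sub_cdf, sub_self] using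
      (tendsto_cdf_atTop (gaussianReal 0 1)).const_sub 1
  have hb : Tendsto gaussQ atBot (nhds 1) := by
    simpa only [← gaussQ_eq_one_sub_cdf, sub_zero] using
      (tendsto_cdf_atBot (gaussianReal 0 1)).const_sub 1
  obtain ⟨a, ha⟩ := (ht.eventually_lt_const h0).exists
  obtain ⟨b, hb⟩ := (hb.eventually_const_lt h1).exists
  exact mem_range_of_exists_le_of_exists_ge continuous_gaussQ ⟨a, ha.le⟩ ⟨b, hb.le⟩

/-- Gordon's upper bound on the Gaussian tail. -/
theorem mul_gaussQ_le {w : ℝ} (hw : 0 ≤ w) : w * gaussQ w ≤ gaussianPDFReal 0 1 w := by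
  have hd : ∀ u ∈ Set.Ici w, HasDerivAt (fun u => -gaussianPDFReal 0 1 u)
      (u * gaussianPDFReal 0 1 u) u := fun u _ => by
    convert! (hasDerivAt_gaussianPDFReal u).neg using 1
    ring
  have hpos : ∀ u ∈ Set.Ioi w, 0 ≤ u * gaussianPDFReal 0 1 u := fun u hu =>
    mul_nonneg (hw.trans (le_of_lt hu)) (gaussianPDFReal_nonneg 0 1 u)
  have ht : Tendsto (fun u => -gaussianPDFReal 0 1 u) atTop (nhds 0) := by
    simpa using tendsto_gaussianPDFReal_atTop.neg
  have h1 := integral_Ioi_of_hasDerivAt_of_nonneg' hd hpos ht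
  have h2 := integrableOn_Ioi_deriv_of_nonneg' hd hpos ht
  rw [zero_sub, neg_neg] at h1
  rw [← h1, gaussQ_eq_integral, ← integral_const_mul]
  refine setIntegral_mono_on ((integrable_gaussianPDFReal 0 1).integrableOn.const_mul w) h2
    measurableSet_Ioi fun u hu => ?_
  exact mul_le_mul_of_nonneg_right (le_of_lt hu) (gaussianPDFReal_nonneg 0 1 u)

/-- The Mills ratio of the standard Gaussian distribution. -/
noncomputable def mills (w : ℝ) : ℝ := gaussQ w / gaussianPDFReal 0 1 w

theorem gaussianPDFReal_ne_zero (w : ℝ) : gaussianPDFReal 0 1 w ≠ 0 :=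
  (gaussianPDFReal_pos 0 1 w one_ne_zero).ne'

/-- Owing to this equation, multiples of `mills w` and `mills (-w)` solve f' - w f = constant. -/
theorem hasDerivAt_mills (w : ℝ) : HasDerivAt mills (w * mills w - 1) w := by
  have h0 := gaussianPDFReal_ne_zero w
  convert! (hasDerivAt_gaussQ w).div (hasDerivAt_gaussianPDFReal w) h0 using 1
  unfold mills
  field_simp
  ring

theorem continuous_mills : Continuous mills :=
  continuous_iff_continuousAt.2 fun x => (hasDerivAt_mills x).continuousAt

theorem mills_nonneg (w : ℝ) : 0 ≤ mills w :=
  div_nonneg (gaussQ_nonneg w) (gaussianPDFReal_nonneg 0 1 w)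

theorem mul_mills_le_one {w : ℝ} (hw : 0 ≤ w) : w * mills w ≤ 1 := by
  rw [mills, ← mul_div_assoc, div_le_one (gaussianPDFReal_pos 0 1 w one_ne_zero)]
  exact mul_gaussQ_le hw

/-- Continuity handles the compact part up to `max x 1`; beyond it, w · mills w ≤ 1 bounds both
quantities. -/
theorem exists_mills_le (x : ℝ) : ∃ B : ℝ, 1 ≤ B ∧ ∀ w, x ≤ w → mills w ≤ B ∧
    |w * mills w| ≤ B := by
  obtain ⟨B₁, h₁⟩ := (isCompact_Icc (a := x) (b := max x 1)).exists_bound_of_continuousOn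
    continuous_mills.continuousOn
  obtain ⟨B₂, h₂⟩ := (isCompact_Icc (a := x) (b := max x 1)).exists_bound_of_continuousOn
    (continuous_id.mul continuous_mills).continuousOn
  refine ⟨max 1 (max B₁ B₂), le_max_left _ _, fun w hw => ?_⟩
  rcases le_total w (max x 1) with h | h
  · have a1 := h₁ w ⟨hw, h⟩
    have a2 := h₂ w ⟨hw, h⟩
    exact ⟨(le_abs_self _).trans (a1.trans (by simp)), a2.trans (by simp)⟩
  · have hw1 : 1 ≤ w := (le_max_right _ _).trans h
    have a := mul_mills_le_one (w := w) (by linarith)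
    have b := mills_nonneg w
    refine ⟨le_trans ?_ (le_max_left _ _), le_trans ?_ (le_max_left _ _)⟩
    · nlinarith
    · rwa [abs_of_nonneg (by positivity)]

/-- The solution of the Stein equation for the indicator function of `Set.Iic x`. -/
noncomputable def steinSol (x w : ℝ) : ℝ :=
  if w ≤ x then gaussQ x * mills (-w) else gaussQ (-x) * mills w

/-- The centred indicator function of `Set.Iic x`. -/
noncomputable def centredInd (x w : ℝ) : ℝ := if w ≤ x then gaussQ x else -gaussQ (-x)

theorem continuous_steinSol (x : ℝ) : Continuous (steinSol x) := by
  refine Continuous.if_le (by have := continuous_mills; fun_prop)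
    (by have := continuous_mills; fun_prop) continuous_id continuous_const ?_
  rintro w rfl
  simp only [mills, gaussianPDFReal_neg]
  ring

theorem hasDerivAt_steinSol {x w : ℝ} (h : w ≠ x) :
    HasDerivAt (steinSol x) (w * steinSol x w + centredInd x w) w := by
  rcases h.lt_or_gt with h | h
  · have h1 : HasDerivAt (fun w => gaussQ x * mills (-w))
        (gaussQ x * ((-w * mills (-w) - 1) * (-1))) w :=
      ((hasDerivAt_mills (-w)).comp w (hasDerivAt_neg w)).const_mul _
    have h2 : steinSol x =ᶠ[nhds w] fun w => gaussQ x * mills (-w) := by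
      filter_upwards [Iio_mem_nhds h] with u hu
      exact if_pos (le_of_lt hu)
    convert! h1.congr_of_eventuallyEq h2 using 1
    simp only [steinSol, centredInd, if_pos h.le]
    ring
  · have h1 : HasDerivAt (fun w => gaussQ (-x) * mills w)
        (gaussQ (-x) * (w * mills w - 1)) w := (hasDerivAt_mills w).const_mul _
    have h2 : steinSol x =ᶠ[nhds w] fun w => gaussQ (-x) * mills w := by
      filter_upwards [Ioi_mem_nhds h] with u hu
      exact if_neg (not_le_of_gt hu)
    convert! h1.congr_of_eventuallyEq h2 using 1
    simp only [steinSol, centredInd, if_neg (not_le_of_gt h)]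
    ring

/-- Each branch evaluates `mills` only on a half-line bounded below, away from its growth at -∞. -/
theorem exists_steinSol_bound (x : ℝ) : ∃ B : ℝ, 0 < B ∧ ∀ w, |steinSol x w| ≤ B ∧
    |w * steinSol x w + centredInd x w| ≤ B := by
  obtain ⟨B₁, h1, hB₁⟩ := exists_mills_le x
  obtain ⟨B₂, h2, hB₂⟩ := exists_mills_le (-x)
  have key (q m v B : ℝ) (q0 : 0 ≤ q) (q1 : q ≤ 1) (m0 : 0 ≤ m) (hm : m ≤ B)
      (hv : |v * m| ≤ B) : |q * m| ≤ B ∧ |v * (q * m)| ≤ B := by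
    constructor
    · rw [abs_of_nonneg (by positivity)]; nlinarith
    · rw [mul_left_comm, abs_mul, abs_of_nonneg q0]; nlinarith [abs_nonneg (v * m)]
  have hi (w : ℝ) : |centredInd x w| ≤ 1 := by
    unfold centredInd
    split_ifs
    · rw [abs_of_nonneg (gaussQ_nonneg x)]; exact gaussQ_le_one x
    · rw [abs_neg, abs_of_nonneg (gaussQ_nonneg _)]; exact gaussQ_le_one _
  have hs (w : ℝ) : |steinSol x w| ≤ max B₁ B₂ ∧ |w * steinSol x w| ≤ max B₁ B₂ := by
    unfold steinSol
    split_ifs with h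
    · have hb := hB₂ (-w) (by linarith)
      have := key (gaussQ x) (mills (-w)) w B₂ (gaussQ_nonneg x) (gaussQ_le_one x)
        (mills_nonneg _) hb.1 (by simpa using hb.2)
      exact ⟨this.1.trans (le_max_right _ _), this.2.trans (le_max_right _ _)⟩
    · have hb := hB₁ w (by linarith)
      have := key (gaussQ (-x)) (mills w) w B₁ (gaussQ_nonneg _) (gaussQ_le_one _)
        (mills_nonneg _) hb.1 hb.2
      exact ⟨this.1.trans (le_max_left _ _), this.2.trans (le_max_left _ _)⟩
  have hB : 1 ≤ max B₁ B₂ := h1.trans (le_max_left _ _)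
  refine ⟨max B₁ B₂ + 1, by linarith, fun w => ⟨by linarith [(hs w).1], ?_⟩⟩
  exact (abs_add_le _ _).trans (add_le_add (hs w).2 (hi w))

/-- The derivative jumps at `x`, but the mean value theorem still applies if `x` is not interior. -/
theorem exists_steinSol_slope {x a b : ℝ} (hab : a < b) (hx : x ∉ Set.Ioo a b) :
    ∃ ξ ∈ Set.Ioo a b,
      steinSol x b - steinSol x a = (b - a) * (ξ * steinSol x ξ + centredInd x ξ) := by
  obtain ⟨ξ, hξ, h⟩ := exists_hasDerivAt_eq_slope (steinSol x)
    (fun w => w * steinSol x w + centredInd x w) hab (continuous_steinSol x).continuousOn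
    fun w hw => hasDerivAt_steinSol fun e => hx (e ▸ hw)
  refine ⟨ξ, hξ, ?_⟩
  rw [h, mul_div_cancel₀ _ (sub_pos.2 hab).ne']

theorem abs_steinSol_sub_le {x B a b : ℝ}
    (hB : ∀ w, |steinSol x w| ≤ B ∧ |w * steinSol x w + centredInd x w| ≤ B)
    (hab : a ≤ b) :
    |steinSol x b - steinSol x a| ≤ B * (b - a) := by
  have key {a b : ℝ} (hab : a ≤ b) (hx : x ∉ Set.Ioo a b) :
      |steinSol x b - steinSol x a| ≤ B * (b - a) := by
    rcases hab.eq_or_lt with rfl | hab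
    · simp
    obtain ⟨ξ, -, h⟩ := exists_steinSol_slope hab hx
    rw [h, abs_mul, abs_of_pos (sub_pos.2 hab), mul_comm]
    exact mul_le_mul_of_nonneg_right (hB ξ).2 (sub_pos.2 hab).le
  by_cases hx : x ∈ Set.Ioo a b
  · have h1 := key hx.1.le (b := x) (by simp)
    have h2 := key hx.2.le (a := x) (by simp)
    have := abs_sub_le (steinSol x b) (steinSol x x) (steinSol x a)
    linarith
  · exact key hab hx

/-- A step not crossing the jump at `x` has second-order error; a crossing step only has the trivial
first-order bound, recorded by the indicator. -/
theorem abs_steinSol_increment_le {x B w δ : ℝ}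
    (hB : ∀ w, |steinSol x w| ≤ B ∧ |w * steinSol x w + centredInd x w| ≤ B)
    (hδ : 0 < δ) :
    |steinSol x (w + δ) - steinSol x w - δ * (w * steinSol x w + centredInd x w)| ≤
      δ ^ 2 * (B * (|w| + δ + 1)) + 2 * B * δ * (if w ≤ x ∧ x < w + δ then 1 else 0) := by
  have hB0 : 0 ≤ B := (abs_nonneg _).trans (hB 0).1
  have hlip := abs_steinSol_sub_le hB (a := w) (b := w + δ) (by linarith)
  split_ifs with hx
  · have h1 : |δ * (w * steinSol x w + centredInd x w)| ≤ δ * B := by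
      rw [abs_mul, abs_of_pos hδ]
      exact mul_le_mul_of_nonneg_left (hB w).2 hδ.le
    have h2 := abs_sub (steinSol x (w + δ) - steinSol x w)
      (δ * (w * steinSol x w + centredInd x w))
    have h3 : 0 ≤ δ ^ 2 * (B * (|w| + δ + 1)) := by positivity
    linarith
  · obtain ⟨ξ, hξ, h⟩ := exists_steinSol_slope (a := w) (b := w + δ) (by linarith)
      fun hx' => hx ⟨hx'.1.le, hx'.2⟩
    have hind : centredInd x ξ = centredInd x w := by
      unfold centredInd
      have : ξ ≤ x ↔ w ≤ x := by
        constructor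
        · intro h; exact hξ.1.le.trans h
        · intro h; by_contra h'; exact hx ⟨h, by linarith [hξ.2]⟩
      simp only [this]
    have e : steinSol x (w + δ) - steinSol x w - δ * (w * steinSol x w + centredInd x w) =
        δ * (ξ * (steinSol x ξ - steinSol x w) + (ξ - w) * steinSol x w) := by
      rw [h, hind]; ring
    have l1 := abs_steinSol_sub_le hB hξ.1.le
    have l2 : |ξ * (steinSol x ξ - steinSol x w)| ≤ (|w| + δ) * (B * δ) := by
      rw [abs_mul]
      have : |ξ| ≤ |w| + δ := by
        have := abs_add_le w (ξ - w)
        rw [add_sub_cancel, abs_of_pos (sub_pos.2 hξ.1)] at this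
        linarith [hξ.2]
      have : B * (ξ - w) ≤ B * δ := mul_le_mul_of_nonneg_left (by linarith [hξ.2]) hB0
      gcongr
      linarith
    have l3 : |(ξ - w) * steinSol x w| ≤ δ * B := by
      rw [abs_mul, abs_of_pos (sub_pos.2 hξ.1)]
      exact mul_le_mul (by linarith [hξ.2]) (hB w).1 (abs_nonneg _) hδ.le
    rw [e, abs_mul, abs_of_pos hδ]
    have := mul_le_mul_of_nonneg_left ((abs_add_le _ _).trans (add_le_add l2 l3)) hδ.le
    linarith

/-! ### Berry-Esseen estimate at a fixed point. -/

section BerryEsseen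

/-- With W = (k - np)δ, D the increment of f = `steinSol x` over [W, W + δ] and e its error, δp(n -
k) = 1/δ - pW turns the Stein identity into E[W f(W)] = E[D/δ] - p E[W D]. Stein's equation then
gives E[`centredInd`] = E[pWD - e/δ], where every term is O(δ) except the crossing steps. -/
theorem abs_sum_binom_centredInd_le {p x B δ : ℝ} {n : ℕ} (hp0 : 0 < p) (hp1 : p < 1)
    (hδ : 0 < δ) (hδn : n * (p * (1 - p)) * δ ^ 2 = 1)
    (hB : ∀ w, |steinSol x w| ≤ B ∧ |w * steinSol x w + centredInd x w| ≤ B) :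
    |∑ k ∈ Finset.range (n + 1), binom n k p * centredInd x ((k - n * p) * δ)| ≤
      B * δ * (3 + δ) + 2 * B * ∑ k ∈ Finset.range (n + 1), binom n k p *
        (if (k - n * p) * δ ≤ x ∧ x < (k - n * p) * δ + δ then 1 else 0) := by
  have hB0 : 0 ≤ B := (abs_nonneg _).trans (hB 0).1
  set W : ℕ → ℝ := fun k => (k - n * p) * δ with hW
  set D : ℕ → ℝ := fun k => steinSol x (W k + δ) - steinSol x (W k) with hD
  set e : ℕ → ℝ := fun k => D k - δ * (W k * steinSol x (W k) + centredInd x (W k)) with he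
  set I : ℕ → ℝ := fun k => if W k ≤ x ∧ x < W k + δ then 1 else 0 with hI
  have hst := sum_binom_stein p n (fun k => steinSol x (W k))
  have h1 : ∑ k ∈ Finset.range (n + 1), binom n k p * centredInd x (W k) =
      ∑ k ∈ Finset.range (n + 1), binom n k p * (p * W k * D k - e k / δ) := by
    rw [← sub_eq_zero, ← Finset.sum_sub_distrib]
    rw [← sub_eq_zero, ← Finset.sum_sub_distrib] at hst
    rw [← mul_zero (-δ), ← hst, Finset.mul_sum]
    refine Finset.sum_congr rfl fun k _ => ?_
    have hs : W (k + 1) = W k + δ := by simp only [hW]; push_cast; ring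
    have hpn : δ * (p * (n - k)) = 1 / δ - p * W k := by
      simp only [hW]; field_simp; linear_combination hδn
    have : D k = steinSol x (W (k + 1)) - steinSol x (W k) := by rw [hs]
    rw [← this]
    simp only [he]
    have hWk : W k = (k - n * p) * δ := rfl
    field_simp at hpn ⊢
    linear_combination (-(binom n k p) * D k) * hpn
      - binom n k p * δ * steinSol x (W k) * hWk
  have h2 : ∀ k ∈ Finset.range (n + 1), |binom n k p * (p * W k * D k - e k / δ)| ≤
      B * δ * (2 + δ) * binom n k p + B * δ * (n * (p * (1 - p)) * δ ^ 2)⁻¹ * δ ^ 2 *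
        (binom n k p * (k - n * p) ^ 2) + 2 * B * (binom n k p * I k) := by
    intro k _
    have hq := binom_nonneg hp0.le hp1.le n k
    have a1 : |D k| ≤ B * δ := by
      have := abs_steinSol_sub_le hB (a := W k) (b := W k + δ) (by linarith)
      rwa [add_sub_cancel_left] at this
    have a2 : |e k| ≤ δ ^ 2 * (B * (|W k| + δ + 1)) + 2 * B * δ * I k :=
      abs_steinSol_increment_le hB hδ
    have a3 : |p * W k * D k| ≤ |W k| * (B * δ) := by
      rw [abs_mul, abs_mul, abs_of_pos hp0]
      have : p * |W k| ≤ |W k| := by nlinarith [abs_nonneg (W k)]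
      exact mul_le_mul this a1 (abs_nonneg _) (abs_nonneg _)
    have a4 : |e k / δ| ≤ δ * (B * (|W k| + δ + 1)) + 2 * B * I k := by
      rw [abs_div, abs_of_pos hδ, div_le_iff₀ hδ]
      linarith
    -- This reduces the first absolute moment to the variance, which is 1 after scaling.
    have a5 : |W k| ≤ (1 + W k ^ 2) / 2 := by
      rw [← sq_abs]; nlinarith [sq_nonneg (|W k| - 1)]
    have a6 : W k ^ 2 = δ ^ 2 * (k - n * p) ^ 2 := by simp only [hW]; ring
    have a7 : |p * W k * D k - e k / δ| ≤
        B * δ * (2 + δ) + B * δ * (δ ^ 2 * (k - n * p) ^ 2) + 2 * B * I k := by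
      have := mul_le_mul_of_nonneg_left a5 (mul_nonneg hB0 hδ.le)
      have := abs_sub (p * W k * D k) (e k / δ)
      rw [← a6]
      linarith
    rw [abs_mul, abs_of_nonneg hq, hδn]
    have := mul_le_mul_of_nonneg_left a7 hq
    linarith
  rw [h1]
  refine (Finset.abs_sum_le_sum_abs _ _).trans ((Finset.sum_le_sum h2).trans (le_of_eq ?_))
  rw [Finset.sum_add_distrib, Finset.sum_add_distrib, ← Finset.mul_sum, ← Finset.mul_sum,
    ← Finset.mul_sum, sum_binom, sum_binom_variance, hδn]
  linear_combination (B * δ) * hδn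

theorem binomMD_eq_sum_range (p : ℝ) (n d : ℕ) :
    binomMD p n d = ∑ k ∈ Finset.range (n + 1), if d < k then binom n k p else 0 := by
  rw [← Finset.sum_filter, binomMD]
  congr 1
  ext k; simp; omega

theorem sum_binom_centredInd {p x δ y : ℝ} {n : ℕ} (hδ : 0 < δ) (hy : 0 ≤ y)
    (hyx : (y - n * p) * δ = x) :
    ∑ k ∈ Finset.range (n + 1), binom n k p * centredInd x ((k - n * p) * δ) =
      gaussQ x - binomMD p n ⌊y⌋₊ := by
  rw [binomMD_eq_sum_range, ← mul_one (gaussQ x), ← sum_binom p n, Finset.mul_sum,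
    ← Finset.sum_sub_distrib]
  refine Finset.sum_congr rfl fun k _ => ?_
  have h : (k - n * p) * δ ≤ x ↔ ¬ ⌊y⌋₊ < k := by
    rw [Nat.floor_lt hy, not_lt, ← hyx, mul_le_mul_iff_left₀ hδ, sub_le_sub_iff_right]
  unfold centredInd
  by_cases hk : ⌊y⌋₊ < k
  · rw [if_neg (by rwa [h, not_not]), if_pos hk, gaussQ_neg]; ring
  · rw [if_pos (h.2 hk), if_neg hk]; ring

theorem tendsto_sqrt_natCast : Tendsto (fun n : ℕ => √(n : ℝ)) atTop atTop :=
  Real.tendsto_sqrt_atTop.comp tendsto_natCast_atTop_atTop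

/-- The Gaussian approximation of the quantile of the binomial distribution. -/
noncomputable def gaussQuantile (p x : ℝ) (n : ℕ) : ℝ := n * p + √(p * (1 - p)) * x * √n

theorem eventually_gaussQuantile_nonneg {p : ℝ} (hp0 : 0 < p) (x : ℝ) :
    ∀ᶠ n : ℕ in atTop, 0 ≤ gaussQuantile p x n := by
  filter_upwards [tendsto_sqrt_natCast.eventually_ge_atTop (-(√(p * (1 - p)) * x) / p)] with n h
  rw [div_le_iff₀ hp0] at h
  have hs := Real.mul_self_sqrt (Nat.cast_nonneg (α := ℝ) n)
  have := mul_le_mul_of_nonneg_right h (Real.sqrt_nonneg (n : ℝ))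
  unfold gaussQuantile
  rw [← hs] at *
  nlinarith

theorem abs_sub_mean_le_of_near {p x J k : ℝ} {n : ℕ}
    (hk : |k - gaussQuantile p x n| ≤ J * √n) :
    |k - n * p| ≤ (|√(p * (1 - p)) * x| + J) * √n := by
  have h := abs_add_le (k - gaussQuantile p x n) (√(p * (1 - p)) * x * √n)
  rw [abs_mul _ √(n : ℝ), abs_of_nonneg (Real.sqrt_nonneg (n : ℝ)),
    show k - gaussQuantile p x n + √(p * (1 - p)) * x * √n = k - n * p by
      unfold gaussQuantile; ring] at h
  linarith

theorem abs_floor_sub_le {y : ℝ} (hy : 0 ≤ y) : |(⌊y⌋₊ : ℝ) - y| ≤ 1 := by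
  rw [abs_le]
  constructor <;> linarith [Nat.floor_le hy, Nat.lt_floor_add_one y]

theorem exists_abs_binomMD_sub_gaussQ_le {p : ℝ} (hp0 : 0 < p) (hp1 : p < 1) (x : ℝ) :
    ∃ C : ℝ, ∀ᶠ n : ℕ in atTop,
      |binomMD p n ⌊gaussQuantile p x n⌋₊ - gaussQ x| ≤ C / √n := by
  obtain ⟨B, hB0, hB⟩ := exists_steinSol_bound x
  obtain ⟨c, C, -, hC0, hC⟩ := exists_binom_bounds hp0 hp1 (|√(p * (1 - p)) * x| + 1)
  have hv : 0 < p * (1 - p) := mul_pos hp0 (by linarith)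
  set σ := √(p * (1 - p)) with hσ
  have hσ0 : 0 < σ := Real.sqrt_pos.2 hv
  refine ⟨B * (1 / σ) * (3 + 1 / σ) + 2 * B * C, ?_⟩
  filter_upwards [hC, eventually_gaussQuantile_nonneg hp0 x, eventually_ge_atTop 1]
    with n hbin hy hn
  have hn' : (0 : ℝ) < n := by exact_mod_cast hn
  have hs0 : 0 < √(n : ℝ) := Real.sqrt_pos.2 hn'
  have hs1 : 1 ≤ √(n : ℝ) := Real.one_le_sqrt.2 (by exact_mod_cast hn)
  set y := gaussQuantile p x n with hydef
  set δ := 1 / (σ * √n) with hδdef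
  have hδ : 0 < δ := by positivity
  have hδn : n * (p * (1 - p)) * δ ^ 2 = 1 := by
    rw [hδdef, div_pow, mul_pow, hσ, Real.sq_sqrt hv.le, Real.sq_sqrt hn'.le]
    have : 1 - p ≠ 0 := by linarith
    field_simp
  have hyx : (y - n * p) * δ = x := by
    rw [hydef, gaussQuantile, hδdef, ← hσ]; field_simp; ring
  have key := abs_sum_binom_centredInd_le hp0 hp1 hδ hδn hB
  rw [sum_binom_centredInd hδ hy hyx, abs_sub_comm] at key
  refine key.trans ?_
  have hm := hbin ⌊y⌋₊ (abs_sub_mean_le_of_near ((abs_floor_sub_le hy).trans (by linarith)))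
  -- Only k = ⌊y⌋ can take a step across `x`, so the local upper bound replaces a concentration
  -- inequality.
  have hbad : ∑ k ∈ Finset.range (n + 1), binom n k p *
      (if (k - n * p) * δ ≤ x ∧ x < (k - n * p) * δ + δ then 1 else 0) ≤ C / √n := by
    refine le_trans (Finset.sum_le_sum (g := fun k => if k = ⌊y⌋₊ then binom n k p else 0)
      fun k _ => ?_) ?_
    · split_ifs with h1 h2 h2
      · simp
      · refine absurd ((Nat.floor_eq_iff hy).2 ⟨?_, ?_⟩).symm h2
        · have := h1.1
          rw [← hyx, mul_le_mul_iff_left₀ hδ] at this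
          linarith
        · have := h1.2
          rw [← hyx, ← add_one_mul, mul_lt_mul_iff_left₀ hδ] at this
          linarith
      · simpa using binom_nonneg hp0.le hp1.le n k
      · simp
    · rw [Finset.sum_ite_eq', if_pos (Finset.mem_range_succ_iff.2 hm.1)]
      exact hm.2.2
  have hδ1 : δ ≤ 1 / σ := by
    rw [hδdef]
    exact one_div_le_one_div_of_le hσ0 (by nlinarith)
  have e : (B * (1 / σ) * (3 + 1 / σ) + 2 * B * C) / √n =
      B * δ * (3 + 1 / σ) + 2 * B * (C / √n) := by
    rw [hδdef]; field_simp
  rw [e]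
  gcongr

end BerryEsseen

/-! ### Location of the binomial quantile. -/

theorem binomMD_antitone {p : ℝ} (hp0 : 0 ≤ p) (hp1 : p ≤ 1) (n : ℕ) :
    Antitone (binomMD p n) := by
  intro a b hab
  exact Finset.sum_le_sum_of_subset_of_nonneg (Finset.Ioc_subset_Ioc_left hab)
    fun k _ _ => binom_nonneg hp0 hp1 n k

theorem binomMD_add_le {p c : ℝ} {n d j : ℕ}
    (h : ∀ i, d < i → i ≤ d + j → i ≤ n ∧ c ≤ binom n i p) :
    binomMD p n (d + j) + j * c ≤ binomMD p n d := by
  induction j with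
  | zero => simp
  | succ j ih =>
    have h1 := ih fun i hi hi' => h i hi (by omega)
    obtain ⟨h2, h3⟩ := h (d + j + 1) (by omega) (by omega)
    have h4 := binomMD_succ (p := p) (n := n) (d := d + j) (by omega)
    rw [← add_assoc]
    push_cast
    linarith

theorem exists_abs_isLeast_sub_gaussQuantile_le {p Pe x : ℝ} (hp0 : 0 < p) (hp1 : p < 1)
    (hx : gaussQ x = Pe) :
    ∃ K : ℝ, ∀ᶠ n : ℕ in atTop, ∀ d : ℕ, IsLeast {k : ℕ | binomMD p n k ≤ Pe} d →
      |(d : ℝ) - gaussQuantile p x n| ≤ K := by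
  obtain ⟨C, hC⟩ := exists_abs_binomMD_sub_gaussQ_le hp0 hp1 x
  obtain ⟨c, _, hc0, _, hc⟩ := exists_binom_bounds hp0 hp1 (|√(p * (1 - p)) * x| + 2)
  -- Each index near y changes the tail by at least c/√n, so `J > C / c` steps outweigh the error
  -- C/√n. Indices within `J` of ⌊y⌋ are within J + 1 ≤ 2√n of y, hence the 2 in the window above.
  obtain ⟨J, hJ⟩ := exists_nat_gt (C / c)
  rw [div_lt_iff₀ hc0] at hJ
  refine ⟨J + 1, ?_⟩
  filter_upwards [hC, hc, eventually_gaussQuantile_nonneg hp0 x, eventually_ge_atTop 1,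
    tendsto_sqrt_natCast.eventually_ge_atTop (J : ℝ)] with n hC hc hy hn hJn d hd
  have hn' : (0 : ℝ) < n := by exact_mod_cast hn
  have hs0 : 0 < √(n : ℝ) := Real.sqrt_pos.2 hn'
  have hs1 : 1 ≤ √(n : ℝ) := Real.one_le_sqrt.2 (by exact_mod_cast hn)
  have hfl := abs_le.1 (abs_floor_sub_le hy)
  set y := gaussQuantile p x n with hydef
  set m := ⌊y⌋₊ with hm
  rw [hx, abs_le] at hC
  have hwin : ∀ i : ℕ, m ≤ i + J → i ≤ m + J → i ≤ n ∧ c / √n ≤ binom n i p := by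
    intro i h1 h2
    have h1' : (m : ℝ) ≤ i + J := by exact_mod_cast h1
    have h2' : (i : ℝ) ≤ m + J := by exact_mod_cast h2
    have := hc i (abs_sub_mean_le_of_near (by
      rw [← hydef, abs_le]
      constructor <;> linarith))
    exact ⟨this.1, this.2.1⟩
  have hJc : C / √n < J * (c / √n) := by
    rw [← mul_div_assoc]
    exact div_lt_div_of_pos_right hJ hs0
  have hup : d ≤ m + J := by
    refine hd.2 ?_
    have := binomMD_add_le (p := p) (n := n) (d := m) (j := J)
      fun i h1 h2 => hwin i (by omega) h2
    change binomMD p n (m + J) ≤ Pe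
    linarith [hC.2]
  have hlow : m ≤ d + J := by
    by_contra! hlt
    have h1 := binomMD_add_le (p := p) (n := n) (d := m - J) (j := J)
      fun i h1 h2 => hwin i (by omega) (by omega)
    rw [Nat.sub_add_cancel (by omega)] at h1
    have h2 := binomMD_antitone hp0.le hp1.le n (show d ≤ m - J by omega)
    have h3 : binomMD p n d ≤ Pe := hd.1
    linarith [hC.1]
  have hup' : (d : ℝ) ≤ m + J := by exact_mod_cast hup
  have hlow' : (m : ℝ) ≤ d + J := by exact_mod_cast hlow
  rw [abs_le]
  constructor <;> linarith

/-! ### False alarm probability and rate. -/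

section rate

theorem binomFA_succ (n d : ℕ) : binomFA n (d + 1) = binomFA n d + binom n (d + 1) (1 / 2) := by
  unfold binomFA
  rw [← Nat.range_succ_eq_Icc_zero, Finset.sum_range_succ, Nat.range_succ_eq_Icc_zero]

theorem binomFA_zero (n : ℕ) : binomFA n 0 = binom n 0 (1 / 2) := by
  simp [binomFA]

theorem binom_half_nonneg (n k : ℕ) : 0 ≤ binom n k (1 / 2) :=
  binom_nonneg (by norm_num) (by norm_num) n k

theorem binom_le_binomFA (n d : ℕ) : binom n d (1 / 2) ≤ binomFA n d :=
  Finset.single_le_sum (f := fun k => binom n k (1 / 2)) (fun k _ => binom_half_nonneg n k)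
    (by simp)

/-- Below the fraction `ρ < 1 / 2` the lower tail of the symmetric binomial distribution is
comparable to its last term. -/
theorem binomFA_le {ρ : ℝ} (hρ0 : 0 < ρ) (hρ1 : ρ < 1 / 2) {n d : ℕ} (hn : 1 ≤ n)
    (hd : (d : ℝ) ≤ n * ρ) :
    binomFA n d ≤ (1 - ρ) / (1 - 2 * ρ) * binom n d (1 / 2) := by
  have hn' : (0 : ℝ) < n := by exact_mod_cast hn
  have h2 : 0 < 1 - 2 * ρ := by linarith
  have h1 : 0 < 1 - ρ := by linarith
  induction d with
  | zero =>
    rw [binomFA_zero]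
    refine le_mul_of_one_le_left (binom_half_nonneg n 0) ?_
    rw [one_le_div h2]; linarith
  | succ d ih =>
    push_cast at hd
    have ih := ih (by linarith)
    have hdn : (d : ℝ) ≤ n := by nlinarith
    have hs := binom_succ (1 / 2) (n := n) (k := d) (by exact_mod_cast hdn)
    have hq := binom_half_nonneg n d
    have hq' := binom_half_nonneg n (d + 1)
    -- Consecutive terms have ratio at most r = ρ/(1-ρ) < 1; the constant in the statement is the
    -- geometric sum 1/(1-r).
    have hstep : (1 - ρ) * binom n d (1 / 2) ≤ ρ * binom n (d + 1) (1 / 2) := by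
      have e1 : (n * (1 - ρ)) * binom n d (1 / 2) ≤ (n - d) * binom n d (1 / 2) :=
        mul_le_mul_of_nonneg_right (by linarith) hq
      have e2 : (d + 1) * binom n (d + 1) (1 / 2) ≤ (n * ρ) * binom n (d + 1) (1 / 2) :=
        mul_le_mul_of_nonneg_right hd hq'
      refine le_of_mul_le_mul_left ?_ hn'
      linarith
    rw [binomFA_succ]
    have e : (1 - ρ) / (1 - 2 * ρ) * binom n (d + 1) (1 / 2) =
        ρ / (1 - 2 * ρ) * binom n (d + 1) (1 / 2) + binom n (d + 1) (1 / 2) := by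
      rw [← add_one_mul, div_add_one h2.ne']
      ring_nf
    rw [e]
    refine add_le_add_left (ih.trans ?_) _
    rw [div_mul_eq_mul_div, div_mul_eq_mul_div]
    exact div_le_div_of_nonneg_right hstep h2.le

/-- Change of measure: the log-ratio of the two laws is affine in `k`. -/
theorem log_binom_half {p : ℝ} (hp0 : 0 < p) (hp1 : p < 1) {n k : ℕ} (hk : k ≤ n) :
    Real.log (binom n k (1 / 2)) = Real.log (binom n k p) - n * Real.log 2 -
      (n - k) * Real.log (1 - p) - k * Real.log p := by
  rw [log_binom hp0 hp1 hk, log_binom (by norm_num) (by norm_num) hk, Nat.cast_sub hk,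
    show (1 - 1 / 2 : ℝ) = 2⁻¹ by norm_num, show (1 / 2 : ℝ) = 2⁻¹ by norm_num, Real.log_inv]
  ring

theorem mul_normalApprox {p Pe : ℝ} (hp0 : 0 < p) (hp1 : p < 1 / 2) {n : ℕ} (hn : 1 ≤ n) :
    n * Real.log 2 * normalApprox (capacity p) (dispersion p) Pe n =
      n * (Real.log 2 + p * Real.log p + (1 - p) * Real.log (1 - p)) -
        √(p * (1 - p)) * gaussQInv Pe * √n * (Real.log (1 - p) - Real.log p) +
        Real.log n / 2 := by
  have hn' : (0 : ℝ) < n := by exact_mod_cast hn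
  have hs0 : 0 < √(n : ℝ) := Real.sqrt_pos.2 hn'
  have hq : 0 < 1 - p := by linarith
  have hl : 0 ≤ Real.log ((1 - p) / p) :=
    Real.log_nonneg (by rw [one_le_div hp0]; linarith)
  have h2 : Real.log 2 ≠ 0 := (Real.log_pos one_lt_two).ne'
  have hv : √(dispersion p / n) = √(p * (1 - p)) * Real.log ((1 - p) / p) * √n / n := by
    rw [dispersion, Real.sqrt_div' _ hn'.le, Real.sqrt_mul (mul_nonneg hp0.le hq.le),
      Real.sqrt_sq hl, div_eq_div_iff hs0.ne' hn'.ne', mul_assoc _ √(n : ℝ),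
      Real.mul_self_sqrt hn'.le]
  rw [normalApprox, hv, capacity, entropy, Real.log_div hq.ne' hp0.ne']
  simp only [Real.logb, Real.log_exp]
  field_simp
  ring

theorem exists_abs_log_binom_half_le {p : ℝ} (Pe : ℝ) (hp0 : 0 < p) (hp1 : p < 1 / 2) (K : ℝ) :
    ∃ C : ℝ, ∀ᶠ n : ℕ in atTop, ∀ k : ℕ, |(k : ℝ) - gaussQuantile p (gaussQInv Pe) n| ≤ K →
      k ≤ n ∧ |Real.log (binom n k (1 / 2)) +
        n * Real.log 2 * normalApprox (capacity p) (dispersion p) Pe n| ≤ C := by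
  have hp1' : p < 1 := by linarith
  obtain ⟨C, hC⟩ := exists_abs_log_binom_le hp0 hp1' (|√(p * (1 - p)) * gaussQInv Pe| + |K|)
  refine ⟨C + K * |Real.log (1 - p) - Real.log p|, ?_⟩
  filter_upwards [hC, eventually_ge_atTop 1] with n hC hn k hk
  have hs1 : 1 ≤ √(n : ℝ) := Real.one_le_sqrt.2 (by exact_mod_cast hn)
  obtain ⟨hkn, h⟩ := hC k (abs_sub_mean_le_of_near
    (hk.trans ((le_abs_self K).trans (le_mul_of_one_le_right (abs_nonneg K) hs1))))
  refine ⟨hkn, ?_⟩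
  rw [log_binom_half hp0 hp1' hkn, mul_normalApprox hp0 hp1 hn]
  have h2 : |(k - gaussQuantile p (gaussQInv Pe) n) * (Real.log (1 - p) - Real.log p)| ≤
      K * |Real.log (1 - p) - Real.log p| := by
    rw [abs_mul]
    exact mul_le_mul_of_nonneg_right hk (abs_nonneg _)
  -- The affine terms sum exactly to (k - y)(ln(1-p) - ln p).
  convert! (abs_add_le _ _).trans (add_le_add h h2) using 2
  unfold gaussQuantile
  ring

theorem isBigO_sub_normalApprox {p Pe : ℝ} (hp0 : 0 < p) (hp1 : p < 1 / 2) (hPe0 : 0 < Pe)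
    (hPe1 : Pe < 1) {d : ℕ → ℕ} {ζ : ℕ → ℝ}
    (hd : ∀ n, 1 ≤ n → IsLeast {k : ℕ | binomMD p n k ≤ Pe} (d n))
    (hζ0 : ∀ n, 1 ≤ n → 0 ≤ ζ n) (hζ1 : ∀ n, 1 ≤ n → ζ n < 1) :
    (fun n : ℕ => -(1 / (n : ℝ)) * Real.logb 2 (binomFA n (d n) - ζ n * binom n (d n) (1 / 2)) -
      normalApprox (capacity p) (dispersion p) Pe n) =O[atTop] (fun n : ℕ => 1 / (n : ℝ)) := by
  have hp1' : p < 1 := by linarith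
  set x := gaussQInv Pe with hxdef
  obtain ⟨K, hK⟩ := exists_abs_isLeast_sub_gaussQuantile_le hp0 hp1'
    (gaussQ_gaussQInv hPe0 hPe1)
  -- The radius `K + 1` covers d - 1 too: ζ may be close to 1, so the lower bound on the false alarm
  -- probability uses the term at d - 1.
  obtain ⟨C, hC⟩ := exists_abs_log_binom_half_le Pe hp0 hp1 (K + 1)
  -- Any ρ strictly between p and 1/2 works. The two conditions on √n below give d ≥ 1 and d ≤ nρ.
  set ρ := (p + 1 / 2) / 2 with hρ
  set M := (1 - ρ) / (1 - 2 * ρ) with hM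
  have hM0 : 0 < M := div_pos (by linarith) (by linarith)
  have hl2 : 0 < Real.log 2 := Real.log_pos one_lt_two
  set S := |√(p * (1 - p)) * x| + |K| with hS
  refine IsBigO.of_bound ((C + |Real.log M|) / Real.log 2) ?_
  filter_upwards [hK, hC, eventually_ge_atTop 1,
    tendsto_sqrt_natCast.eventually_ge_atTop ((S + 1) / p),
    tendsto_sqrt_natCast.eventually_ge_atTop (S / (ρ - p))] with n hK hC hn hn1 hn2
  have hn' : (0 : ℝ) < n := by exact_mod_cast hn
  have hs1 : 1 ≤ √(n : ℝ) := Real.one_le_sqrt.2 (by exact_mod_cast hn)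
  have hss := Real.mul_self_sqrt hn'.le
  have hKd := hK (d n) (hd n hn)
  have hz0 := hζ0 n hn
  have hz1 := hζ1 n hn
  generalize d n = d at *
  generalize ζ n = ζ at *
  have hmean := abs_le.1 (abs_sub_mean_le_of_near
    (hKd.trans ((le_abs_self K).trans (le_mul_of_one_le_right (abs_nonneg K) hs1))))
  rw [← hxdef, ← hS] at hmean
  rw [div_le_iff₀ hp0] at hn1
  rw [div_le_iff₀ (by linarith)] at hn2
  have hd1 : (1 : ℝ) ≤ d := by nlinarith [hmean.1]
  have hdρ : (d : ℝ) ≤ n * ρ := by nlinarith [hmean.2]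
  obtain ⟨e, rfl⟩ : ∃ e, d = e + 1 := Nat.exists_eq_add_of_le' (by exact_mod_cast hd1)
  obtain ⟨hkn, h1⟩ := hC (e + 1) (by linarith)
  obtain ⟨-, h0⟩ := hC e (by
    have := abs_le.1 hKd
    push_cast at this
    rw [abs_le]; constructor <;> linarith)
  have hq1 := binom_pos (p := 1 / 2) (by norm_num) (by norm_num) hkn
  have hq0 := binom_pos (p := 1 / 2) (n := n) (k := e) (by norm_num) (by norm_num) (by omega)
  set T := binomFA n (e + 1) - ζ * binom n (e + 1) (1 / 2) with hT
  have hTlow : binom n e (1 / 2) ≤ T := by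
    have := binom_le_binomFA n e
    rw [hT, binomFA_succ]
    nlinarith
  have hTup : T ≤ M * binom n (e + 1) (1 / 2) := by
    have := binomFA_le (by linarith) (by linarith) hn hdρ
    have := mul_nonneg hz0 hq1.le
    rw [hT]
    linarith
  have hT0 : 0 < T := hq0.trans_le hTlow
  have l0 := Real.log_le_log hq0 hTlow
  have l1 := Real.log_le_log hT0 hTup
  rw [Real.log_mul hM0.ne' hq1.ne'] at l1
  have hfin : |Real.log T + n * Real.log 2 * normalApprox (capacity p) (dispersion p) Pe n| ≤
      C + |Real.log M| := by
    rw [abs_le] at h0 h1 ⊢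
    constructor
    · linarith [abs_nonneg (Real.log M)]
    · linarith [le_abs_self (Real.log M)]
  have e : -(1 / (n : ℝ)) * Real.logb 2 T - normalApprox (capacity p) (dispersion p) Pe n =
      -(Real.log T + n * Real.log 2 * normalApprox (capacity p) (dispersion p) Pe n) /
        (Real.log 2 * n) := by
    rw [Real.logb]; field_simp; ring
  rw [e, Real.norm_eq_abs, Real.norm_eq_abs, abs_div, abs_neg, abs_of_pos (mul_pos hl2 hn'),
    abs_of_pos (one_div_pos.2 hn'), div_mul_div_comm, mul_one]
  gcongr

end rate

end BSC

theorem mainTheorem4 (p Pe : ℝ) (hp0 : 0 < p) (hp1 : p < 1 / 2) (hPe0 : 0 < Pe) (hPe1 : Pe < 1) :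
    ∃ Rbar : ℕ → ℝ,
      (∀ n : ℕ, 1 ≤ n → ∀ (a : BSC.Word n) (R : ℝ),
        BSC.IsMetaConverse p Pe a R ↔ R = Rbar n) ∧
      (∀ n : ℕ, 1 ≤ n → ∃ (d : ℕ) (ζ : ℝ),
        IsLeast {k : ℕ | BSC.binomMD p n k ≤ Pe} d ∧ d ≤ n ∧ 0 ≤ ζ ∧ ζ < 1 ∧
        Pe = BSC.binomMD p n d + ζ * BSC.binom n d p ∧
        Rbar n = -(1 / (n : ℝ)) *
          Real.logb 2 (BSC.binomFA n d - ζ * BSC.binom n d (1 / 2))) ∧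
      (fun n : ℕ => Rbar n - BSC.normalApprox (BSC.capacity p) (BSC.dispersion p) Pe n)
        =O[atTop] (fun n : ℕ => 1 / (n : ℝ)) := by
  have hp1' : p < 1 := by linarith
  choose d ζ hd hdn hζ0 hζ1 hPe using fun n => BSC.exists_threshold hp0 hp1' hPe0 hPe1 n
  refine ⟨fun n => -(1 / (n : ℝ)) *
    Real.logb 2 (BSC.binomFA n (d n) - ζ n * BSC.binom n (d n) (1 / 2)), fun n hn a R => ?_,
    fun n _ => ⟨d n, ζ n, hd n, hdn n, hζ0 n, hζ1 n, hPe n, rfl⟩,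
    BSC.isBigO_sub_normalApprox hp0 hp1 hPe0 hPe1 (fun n _ => hd n) (fun n _ => hζ0 n)
      fun n _ => hζ1 n⟩
  have h := BSC.isMetaConverse_of_binom hp0 hp1 hn (hdn n) (hζ0 n) (hζ1 n) (hPe n) a
  exact ⟨fun hR => hR.unique hp0 hp1' h, fun hR => hR ▸ h⟩
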